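/- Let $G$ be a Frobenius group on a set $\Omega$: a finite group acting faithfully and transitively on $\Omega$ such that no non-trivial element fixes more than one point. Let $\omega\in\Omega$, let $H=G_\omega$ be the Frobenius complement, i.e. the stabilizer of $\omega$, and let $$K=\Bigl(G\setminus\bigcup_{g\in G} gHg^{-1}\Bigr)\cup\{e\}$$ be the Frobenius kernel. For $a,b\in\Omega$ put $G_{a\to b}=\{g\in G: g(a)=b\}$. A subset $L\subseteq G$ is called a *CL set* (Cameron–Liebler set) if its characteristic vector $\mathbf v_L\in\mathbb C^G$ is a $\mathbb C$-linear combination of the characteristic vectors of the sets $G_{a\to b}$, $a,b\in\Omega$. A *minimal* CL set is a non-empty CL set that has no non-empty CL set as a proper subset. For a function $f:H\to K$ put $S_f=\{f(h)h : h\in H\}$. Then: 1. For every function $f:H\to K$, the set $S_f$ is a CL set. 2. The minimal CL sets are exactly the sets $S_f$ with $f:H\to K$. In particular, every minimal CL set $L$ equals $\{f(h)h: h\in H\}$ for some function $f:H\to K$. 3. A subset of $G$ is a CL set if and only if it is a disjoint union of sets $S_f$, i.e. it equals $\bigcup_{f\in F}S_f$ for some (possibly empty) set $F$ of functions $H\to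 K$ whose sets $S_f$ are pairwise disjoint. -/

import Mathlib

/-- The action of `G` on `Ω` makes `G` a Frobenius group: `G` is finite and acts faithfully (so it is
a finite permutation group on `Ω`) and transitively, and no non-trivial element fixes more than one
point. -/
structure IsFrobeniusGroup (G Ω : Type*) [Group G] [MulAction G Ω] : Prop where
  finite : Finite G
  faithful : FaithfulSMul G Ω
  transitive : MulAction.IsPretransitive G Ω
  eq_of_fixed : ∀ g : G, g ≠ 1 → ∀ a b : Ω, g • a = a → g • b = b → a = b

/-- The Frobenius complement: the stabilizer of the point `ω`. -/
abbrev frobeniusComplement (G : Type*) {Ω : Type*} [Group G] [MulAction G Ω] (ω : Ω) :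
    Subgroup G :=
  MulAction.stabilizer G ω

/-- The Frobenius kernel: the identity together with all elements of `G` lying in no conjugate
`g H g⁻¹` of the Frobenius complement `H`. It is defined as a set; nothing about it is assumed. -/
def frobeniusKernel (G : Type*) {Ω : Type*} [Group G] [MulAction G Ω] (ω : Ω) : Set G :=
  (⋃ g : G, (fun x : G => g * x * g⁻¹) '' (frobeniusComplement G ω : Set G))ᶜ ∪ {1}

/-- The star of all group elements sending `a` to `b`. -/
def clStar (G : Type*) {Ω : Type*} [Group G] [MulAction G Ω] (a b : Ω) : Set G :=
  {g : G | g • a = b}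

/-- The characteristic vector of a subset of `G`, as a complex vector indexed by `G`. -/
noncomputable def charVec {G : Type*} (S : Set G) : G → ℂ :=
  S.indicator 1

/-- Cameron-Liebler sets: subsets of `G` whose characteristic vector is a linear combination of
the characteristic vectors of the stars. -/
def IsCLSet {G : Type*} (Ω : Type*) [Group G] [MulAction G Ω] (L : Set G) : Prop :=
  charVec L ∈ Submodule.span ℂ {v : G → ℂ | ∃ a b : Ω, v = charVec (clStar G a b)}

/-- Minimal Cameron-Liebler sets: non-empty ones with no non-empty Cameron-Liebler set as a proper
subset. -/
def IsMinimalCLSet {G : Type*} (Ω : Type*) [Group G] [MulAction G Ω] (L : Set G) : Prop :=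
  IsCLSet Ω L ∧ L.Nonempty ∧ ∀ M : Set G, IsCLSet Ω M → M.Nonempty → ¬ M ⊂ L

/-- The set `S_f = {f(h) h : h ∈ H}` for a function `f : H → K`. -/
def transversalSet {G Ω : Type*} [Group G] [MulAction G Ω] {ω : Ω}
    (f : frobeniusComplement G ω → frobeniusKernel G ω) : Set G :=
  {x : G | ∃ h : frobeniusComplement G ω, x = (f h : G) * (h : G)}

/-! Everything rests on Frobenius's theorem that `K` is closed under multiplication
(`mul_mem_frobeniusKernel`); then `K` acts regularly on `Ω` and `G = KH` with unique factorization.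

Given this, each star meets each coset `Kg` exactly once, so a vector in the span of the stars has
the same sum over every coset (`sum_coset_eq`). A CL set thus meets all cosets in the same number
`m` of points, and listing these points coset by coset cuts it into `m` disjoint sets `S_f`.
Conversely, moving one point within its coset changes the characteristic vector by an element of the
span (`charVec_singleton_sub_mem_clSpan`). Since `H` is itself a star, every `S_f` is a CL set.
Minimality follows, as no `S_f` properly contains another.

Frobenius's theorem is proved in the group algebra: the sum `σ` of `K` acts on each simple module as
`0` or `|K|`, so `σ² = |K|σ`, and comparing coefficients shows that `K` is closed under products. -/

open scoped ComplexConjugate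

/-! ### Complex characters of finite groups -/

/-- The trace of the inverse of a complex endomorphism of finite order is the conjugate of its
trace. -/
theorem LinearMap.trace_eq_conj_of_mul_eq_one {V : Type*} [AddCommGroup V] [Module ℂ V]
    [FiniteDimensional ℂ V] {f g : Module.End ℂ V} {n : ℕ} (hn : n ≠ 0) (hf : f ^ n = 1)
    (hgf : g * f = 1) :
    LinearMap.trace ℂ V g = conj (LinearMap.trace ℂ V f) := by
  classical
  -- `f` is a root of the separable polynomial `X ^ n - 1`, hence diagonalizable; its eigenvalues
  -- are roots of unity, whose inverses are their conjugates.
  have hss : f.IsSemisimple := by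
    refine Module.End.isSemisimple_of_squarefree_aeval_eq_zero
      (p := (Polynomial.X ^ n - Polynomial.C (1 : ℂ))) ?_ (by simp [hf])
    exact (Polynomial.separable_X_pow_sub_C (1 : ℂ) (by exact_mod_cast hn)
      one_ne_zero).squarefree
  have hint : DirectSum.IsInternal f.eigenspace :=
    DirectSum.isInternal_submodule_of_iSupIndep_of_iSup_eq_top f.eigenspaces_iSupIndep
      hss.iSup_eigenspace_eq_top
  have heig : ∀ μ : ℂ, ∀ v ∈ f.eigenspace μ, f v = μ • v := fun μ v hv =>
    Module.End.mem_eigenspace_iff.1 hv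
  have hnorm : ∀ μ : ℂ, f.eigenspace μ ≠ ⊥ → ‖μ‖ = 1 := by
    intro μ hμ
    obtain ⟨v, hv, hv0⟩ := Submodule.exists_mem_ne_zero_of_ne_bot hμ
    have hpow : ∀ m : ℕ, (f ^ m) v = μ ^ m • v := by
      intro m
      induction m with
      | zero => simp
      | succ m ih =>
        rw [pow_succ', Module.End.mul_apply, ih, map_smul, heig μ v hv, smul_smul, pow_succ]
    have h1 : μ ^ n = 1 := by
      have h2 := hpow n
      rw [hf, Module.End.one_apply] at h2
      have h3 : (μ ^ n - 1) • v = 0 := by rw [sub_smul, ← h2, one_smul, sub_self]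
      rcases smul_eq_zero.1 h3 with h | h
      · exact sub_eq_zero.1 h
      · exact absurd h hv0
    exact Complex.norm_eq_one_of_pow_eq_one h1 hn
  have hginv : ∀ μ : ℂ, ∀ v ∈ f.eigenspace μ, g v = conj μ • v := by
    intro μ v hv
    by_cases hv0 : v = 0
    · simp [hv0]
    have hμ := hnorm μ (fun h => hv0 (by simpa [h] using hv))
    have h1 : g (f v) = v := by rw [← Module.End.mul_apply, hgf, Module.End.one_apply]
    rw [heig μ v hv, map_smul] at h1
    have h2 : conj μ * μ = 1 := by
      rw [mul_comm, Complex.mul_conj, Complex.normSq_eq_norm_sq, hμ]; simp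
    calc g v = (conj μ * μ) • g v := by rw [h2, one_smul]
      _ = conj μ • v := by rw [mul_smul, h1]
  have hfin : {μ : ℂ | f.eigenspace μ ≠ ⊥}.Finite :=
    WellFoundedGT.finite_ne_bot_of_iSupIndep f.eigenspaces_iSupIndep
  have hfm : ∀ μ : ℂ, Set.MapsTo f (f.eigenspace μ) (f.eigenspace μ) := by
    intro μ v hv
    rw [heig μ v hv]; exact Submodule.smul_mem _ _ hv
  have hgm : ∀ μ : ℂ, Set.MapsTo g (f.eigenspace μ) (f.eigenspace μ) := by
    intro μ v hv
    rw [hginv μ v hv]; exact Submodule.smul_mem _ _ hv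
  rw [LinearMap.trace_eq_sum_trace_restrict' hint hfin hgm,
    LinearMap.trace_eq_sum_trace_restrict' hint hfin hfm, map_sum]
  refine Finset.sum_congr rfl fun μ _ => ?_
  have h1 : f.restrict (hfm μ) = μ • LinearMap.id := by
    exact LinearMap.ext fun v => Subtype.ext (heig μ v v.2)
  have h2 : g.restrict (hgm μ) = conj μ • LinearMap.id := by
    exact LinearMap.ext fun v => Subtype.ext (hginv μ v v.2)
  rw [h1, h2, map_smul, map_smul, LinearMap.trace_id]
  simp

namespace Representation

variable {G V : Type*} [Group G] [Fintype G] [AddCommGroup V] [Module ℂ V]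
  [FiniteDimensional ℂ V]

/-- The character of a complex representation of a finite group takes conjugate values at inverse
elements. -/
theorem char_inv_eq_conj (ρ : Representation ℂ G V) (g : G) :
    ρ.character g⁻¹ = conj (ρ.character g) := by
  refine LinearMap.trace_eq_conj_of_mul_eq_one (n := Fintype.card G) Fintype.card_ne_zero ?_ ?_
  · rw [← map_pow, pow_card_eq_one, map_one]
  · rw [← map_mul, inv_mul_cancel, map_one]

theorem char_mul_char_inv (ρ : Representation ℂ G V) (g : G) :
    ρ.character g * ρ.character g⁻¹ = ((‖ρ.character g‖ ^ 2 : ℝ) : ℂ) := by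
  rw [char_inv_eq_conj, Complex.mul_conj, Complex.normSq_eq_norm_sq]

/-- The squared norms of the values of a character sum to a natural multiple of the group order. -/
theorem sum_norm_sq_char (ρ : Representation ℂ G V) :
    ∑ g, ‖ρ.character g‖ ^ 2 = Nat.card G * Module.finrank ℂ (IntertwiningMap ρ ρ) := by
  have hne : (Nat.card G : ℂ) ≠ 0 := by exact_mod_cast Nat.card_pos.ne'
  let _ := invertibleOfNonzero hne
  have h := card_inv_mul_sum_char_mul_char_eq_finrank ρ ρ
  rw [inv_mul_eq_iff_eq_mul₀ hne] at h
  simp_rw [char_mul_char_inv] at h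
  exact_mod_cast h

theorem sum_char_eq_card_mul_finrank_invariants (ρ : Representation ℂ G V) :
    ∑ g, ρ.character g = Nat.card G * Module.finrank ℂ (invariants ρ) := by
  have hne : (Nat.card G : ℂ) ≠ 0 := by exact_mod_cast Nat.card_pos.ne'
  let _ := invertibleOfNonzero hne
  have h := card_inv_mul_sum_char_eq_finrank ρ
  rwa [inv_mul_eq_iff_eq_mul₀ hne] at h

end Representation

/-! ### Irreducible characters summed over the kernel -/

namespace Representation

variable {G V : Type*} [Group G] [Fintype G] [AddCommGroup V] [Module ℂ V]
  [FiniteDimensional ℂ V]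

/-- An irreducible representation whose character has non-zero sum is trivial. -/
theorem apply_eq_one_of_sum_char_ne_zero (ρ : Representation ℂ G V) [IsIrreducible ρ]
    (h : ∑ g, ρ.character g ≠ 0) (g : G) : ρ g = 1 := by
  have hinv : invariants ρ ≠ ⊥ := by
    intro hbot
    apply h
    rw [sum_char_eq_card_mul_finrank_invariants, hbot]
    simp
  let W : Subrepresentation ρ := ⟨invariants ρ, fun g v hv => by
    rw [(mem_invariants ρ v).1 hv g]; exact hv⟩
  have hW : W = ⊤ := by
    refine (eq_bot_or_eq_top W).resolve_left fun hb => hinv ?_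
    exact congrArg Subrepresentation.toSubmodule hb
  ext v
  have hv : v ∈ W.toSubmodule := by rw [hW]; exact Submodule.mem_top
  exact (mem_invariants ρ v).1 hv g

/-- Let `K` contain `1` and let `H` be a subgroup such that summing a class function over the
complement of `K` amounts to summing it `|K|` times over the non-trivial elements of `H`. Then the
sum over `K` of an irreducible character is zero or `|K|` times the degree. -/
theorem sum_char_eq_zero_or_eq_card_mul_finrank (ρ : Representation ℂ G V) [IsIrreducible ρ]
    (H : Subgroup G) [Fintype H] (K : Finset G) (one_mem : 1 ∈ K)
    (hsum : ∀ F : G → ℂ, (∀ g x, F (g * x * g⁻¹) = F x) →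
      ∑ g, F g = ∑ k ∈ K, F k + K.card * (∑ h : H, F h - F 1)) :
    ∑ k ∈ K, ρ.character k = 0 ∨
      ∑ k ∈ K, ρ.character k = K.card * Module.finrank ℂ V := by
  by_cases h0 : ∑ g, ρ.character g = 0
  swap
  · right
    have h1 : ∀ k, ρ.character k = Module.finrank ℂ V := fun k => by
      rw [character, apply_eq_one_of_sum_char_ne_zero ρ h0, LinearMap.trace_one]
    simp [h1]
  set χ : G → ℂ := ρ.character with hχ
  set d : ℕ := Module.finrank ℂ V with hd
  set a : ℕ := Module.finrank ℂ (invariants (ρ.comp H.subtype)) with ha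
  set e : ℕ := Module.finrank ℂ (IntertwiningMap (ρ.comp H.subtype) (ρ.comp H.subtype)) with he
  have hχ1 : χ 1 = d := char_one ρ
  have hK0 : (0 : ℝ) < K.card := by exact_mod_cast Finset.card_pos.2 ⟨1, one_mem⟩
  have hH0 : (0 : ℝ) < Nat.card H := by exact_mod_cast Nat.card_pos
  have hcardG : (Nat.card G : ℝ) = K.card * Nat.card H := by
    have h := hsum (fun _ => 1) (fun _ _ => rfl)
    simp only [Finset.sum_const, nsmul_eq_mul, mul_one, Finset.card_univ] at h
    rw [← Nat.card_eq_fintype_card, ← Nat.card_eq_fintype_card] at h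
    have h' : (Nat.card G : ℂ) = K.card * Nat.card H := by rw [h]; ring
    exact_mod_cast h'
  have hHsum : ∑ h : H, χ h = Nat.card H * a :=
    sum_char_eq_card_mul_finrank_invariants (ρ.comp H.subtype)
  have hHnorm : ∑ h : H, ‖χ h‖ ^ 2 = Nat.card H * e :=
    sum_norm_sq_char (ρ.comp H.subtype)
  have hGnorm : ∑ g, ‖χ g‖ ^ 2 = Nat.card G := by
    have h := sum_norm_sq_char ρ
    rwa [IsIrreducible.finrank_intertwiningMap_self, Nat.cast_one, mul_one] at h
  -- `c` is the value at `1` of the virtual character `χ|_H - a·reg`, with `reg` the regular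
  -- character of `H`. It is also the mean of `χ` over `K`, because `χ` sums to zero over `G`.
  set c : ℝ := d - Nat.card H * a with hc
  have hS : ∑ k ∈ K, χ k = K.card * (c : ℂ) := by
    have h := hsum χ (fun g x => char_conj ρ x g)
    rw [h0, hHsum, hχ1] at h
    rw [hc]; push_cast
    linear_combination -h
  have hSnorm : ∑ k ∈ K, ‖χ k‖ ^ 2 = Nat.card G - K.card * (Nat.card H * e - (d : ℝ) ^ 2) := by
    have h := hsum (fun g => ((‖χ g‖ ^ 2 : ℝ) : ℂ)) (fun g x => by
      simp only [hχ, char_conj ρ x g])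
    rw [hχ1] at h
    have h' : ∑ g, ‖χ g‖ ^ 2 = ∑ k ∈ K, ‖χ k‖ ^ 2
        + K.card * (∑ h : H, ‖χ h‖ ^ 2 - ‖(d : ℂ)‖ ^ 2) := by exact_mod_cast h
    rw [hGnorm, hHnorm, Complex.norm_natCast] at h'
    linarith
  -- The integer `n = e - 2ad + a²|H|` is the squared norm of `χ|_H - a·reg`. The deviation of `χ`
  -- from its mean on `K` is `|G|(1 - n)`, so `n` can only be `0` or `1`.
  have hvar : ∑ k ∈ K, ‖χ k - c‖ ^ 2 =
      Nat.card G * (1 - (e - 2 * a * d + (a : ℝ) ^ 2 * Nat.card H)) := by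
    have h1 : ∀ k, ‖χ k - c‖ ^ 2 = ‖χ k‖ ^ 2 - 2 * c * (χ k).re + c ^ 2 := by
      intro k
      rw [← Complex.normSq_eq_norm_sq, ← Complex.normSq_eq_norm_sq, Complex.normSq_apply,
        Complex.normSq_apply]
      simp
      ring
    have h2 : ∑ k ∈ K, (χ k).re = K.card * c := by
      rw [← Complex.re_sum, hS, ← Complex.ofReal_natCast, ← Complex.ofReal_mul, Complex.ofReal_re]
    simp_rw [h1]
    rw [Finset.sum_add_distrib, Finset.sum_sub_distrib, ← Finset.mul_sum, h2, hSnorm, hcardG,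
      Finset.sum_const, nsmul_eq_mul, hc]
    ring
  have hn1 : (e - 2 * a * d + (a : ℤ) ^ 2 * Nat.card H : ℤ) ≤ 1 := by
    have h1 : (0 : ℝ) ≤ ∑ k ∈ K, ‖χ k - c‖ ^ 2 := Finset.sum_nonneg fun _ _ => by positivity
    rw [hvar] at h1
    have h2 := nonneg_of_mul_nonneg_right h1 (by rw [hcardG]; positivity)
    have h3 : (e - 2 * a * d + (a : ℝ) ^ 2 * Nat.card H) ≤ 1 := by linarith
    exact_mod_cast h3
  have hn0 : Nat.card H * (e - 2 * a * d + (a : ℝ) ^ 2 * Nat.card H) =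
      ∑ h : H, ‖χ h‖ ^ 2 - (d : ℝ) ^ 2 + c ^ 2 := by
    rw [hHnorm, hc]; ring
  have hd2 : (d : ℝ) ^ 2 ≤ ∑ h : H, ‖χ h‖ ^ 2 := by
    have h := Finset.single_le_sum (f := fun h : H => ‖χ h‖ ^ 2) (fun _ _ => by positivity)
      (Finset.mem_univ (1 : H))
    simpa [hχ1] using h
  have hn0' : (0 : ℤ) ≤ (e - 2 * a * d + (a : ℤ) ^ 2 * Nat.card H : ℤ) := by
    have h1 : 0 ≤ Nat.card H * (e - 2 * a * d + (a : ℝ) ^ 2 * Nat.card H) := by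
      rw [hn0]; nlinarith [sq_nonneg c]
    have h2 := nonneg_of_mul_nonneg_right h1 hH0
    exact_mod_cast h2
  obtain hn | hn : (e - 2 * a * d + (a : ℤ) ^ 2 * Nat.card H : ℤ) = 0 ∨
      (e - 2 * a * d + (a : ℤ) ^ 2 * Nat.card H : ℤ) = 1 := by omega
  -- `n = 0`: the virtual character vanishes, in particular at `1`, so the mean `c` is zero.
  · left
    have hn' : (e - 2 * a * d + (a : ℝ) ^ 2 * Nat.card H) = 0 := by exact_mod_cast hn
    rw [hn', mul_zero] at hn0
    have hc0 : c = 0 := by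
      have : c ^ 2 ≤ 0 := by linarith
      exact pow_eq_zero_iff (two_ne_zero) |>.1 (le_antisymm this (sq_nonneg c))
    rw [hS, hc0]; simp
  -- `n = 1`: `χ` is constant on `K`, and `1 ∈ K` makes the constant `d`.
  · right
    have hn' : (e - 2 * a * d + (a : ℝ) ^ 2 * Nat.card H) = 1 := by exact_mod_cast hn
    rw [hn', sub_self, mul_zero, Finset.sum_eq_zero_iff_of_nonneg (fun _ _ => by positivity)]
      at hvar
    have h1 := hvar 1 one_mem
    rw [pow_eq_zero_iff two_ne_zero, norm_eq_zero, hχ1, sub_eq_zero] at h1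
    rw [hS, ← h1]

/-- Under the hypotheses of `sum_char_eq_zero_or_eq_card_mul_finrank`, the sum over `K` of the
operators of an irreducible representation is zero or the scalar `|K|`. -/
theorem sum_apply_eq_zero_or_eq_card_smul (ρ : Representation ℂ G V) [IsIrreducible ρ]
    (H : Subgroup G) [Fintype H] (K : Finset G) (one_mem : 1 ∈ K)
    (hconj : ∀ g, ∀ k ∈ K, g * k * g⁻¹ ∈ K)
    (hsum : ∀ F : G → ℂ, (∀ g x, F (g * x * g⁻¹) = F x) →
      ∑ g, F g = ∑ k ∈ K, F k + K.card * (∑ h : H, F h - F 1)) :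
    ∑ k ∈ K, ρ k = 0 ∨ ∑ k ∈ K, ρ k = (K.card : ℂ) • 1 := by
  have hcomm : ∀ g, (∑ k ∈ K, ρ k) ∘ₗ ρ g = ρ g ∘ₗ (∑ k ∈ K, ρ k) := by
    intro g
    change (∑ k ∈ K, ρ k) * ρ g = ρ g * (∑ k ∈ K, ρ k)
    rw [Finset.sum_mul, Finset.mul_sum]
    refine Finset.sum_bij' (fun k _ => g⁻¹ * k * g) (fun k _ => g * k * g⁻¹) ?_ ?_ ?_ ?_ ?_
    · intro k hk; simpa using hconj g⁻¹ k hk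
    · intro k hk; exact hconj g k hk
    · intro k _; group
    · intro k _; group
    · intro k _; rw [← map_mul, ← map_mul]; congr 1; group
  -- Schur's lemma makes the operator a scalar, which its trace determines.
  let T : IntertwiningMap ρ ρ := ⟨∑ k ∈ K, ρ k, fun g => hcomm g⟩
  obtain ⟨s, hs⟩ := (IsIrreducible.algebraMap_intertwiningMap_bijective_of_isAlgClosed
    (ρ := ρ)).2 T
  have hT : ∑ k ∈ K, ρ k = s • (1 : Module.End ℂ V) := by
    have h := congrArg IntertwiningMap.toLinearMap hs
    ext v
    have h' := LinearMap.congr_fun h v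
    exact h'.symm
  have htr : ∑ k ∈ K, ρ.character k = s * Module.finrank ℂ V := by
    have h := congrArg (LinearMap.trace ℂ V) hT
    rw [map_sum, map_smul, LinearMap.trace_one] at h
    exact h
  have : Nontrivial V := by
    have : IsSimpleModule (MonoidAlgebra ℂ G) ρ.asModule := inferInstance
    exact IsSimpleModule.nontrivial (MonoidAlgebra ℂ G) ρ.asModule
  have hd : (Module.finrank ℂ V : ℂ) ≠ 0 := by exact_mod_cast Module.finrank_pos.ne'
  rw [hT]
  rcases sum_char_eq_zero_or_eq_card_mul_finrank ρ H K one_mem hsum with h | h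
  · left
    rw [htr] at h
    rw [(mul_eq_zero.1 h).resolve_right hd, zero_smul]
  · right
    rw [htr] at h
    rw [mul_right_cancel₀ hd h]

end Representation

/-! ### From simple modules to the group algebra -/

namespace Representation

section ScalarTower

variable {k G M : Type*} [Field k] [Group G] [AddCommGroup M] [Module k M]
  [Module (MonoidAlgebra k G) M] [IsScalarTower k (MonoidAlgebra k G) M]

/-- The representation on a module over the group algebra with compatible scalar actions. -/
noncomputable def ofScalarTower : Representation k G M :=
  ((Algebra.lsmul k k M : MonoidAlgebra k G →ₐ[k] Module.End k M) :
    MonoidAlgebra k G →* Module.End k M).comp (MonoidAlgebra.of k G)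

theorem asAlgebraHom_ofScalarTower_apply (x : MonoidAlgebra k G) (m : M) :
    (ofScalarTower : Representation k G M).asAlgebraHom x m = x • m := by
  have h : (ofScalarTower : Representation k G M).asAlgebraHom = Algebra.lsmul k k M := by
    refine MonoidAlgebra.algHom_ext (fun g => ?_) (Subsingleton.elim _ _)
    rw [asAlgebraHom_single_one]
    rfl
  rw [h]
  rfl

theorem isIrreducible_ofScalarTower [IsSimpleModule (MonoidAlgebra k G) M] :
    (ofScalarTower : Representation k G M).IsIrreducible := by
  rw [irreducible_iff_isSimpleModule_asModule]
  let e : (ofScalarTower : Representation k G M).asModule ≃ₗ[MonoidAlgebra k G] M :=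
    { (ofScalarTower : Representation k G M).asModuleEquiv.toAddEquiv with
      map_smul' := fun r x => by
        refine ((ofScalarTower : Representation k G M).asModuleEquiv_map_smul r x).trans ?_
        exact asAlgebraHom_ofScalarTower_apply (k := k) (G := G) (M := M) r _ }
  exact IsSimpleModule.congr e

end ScalarTower

end Representation

/-- An element of a semisimple ring that annihilates every simple quotient of the ring is zero. -/
theorem IsSemisimpleRing.eq_zero_of_forall_isSimpleModule {R : Type*} [Ring R] [IsSemisimpleRing R]
    {x : R} (h : ∀ I : Ideal R, IsSimpleModule R (R ⧸ I) → ∀ m : R ⧸ I, x • m = 0) : x = 0 := by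
  have hx : x ∈ Ring.jacobson R := by
    rw [Ring.jacobson_eq_sInf_isMaximal, Submodule.mem_sInf]
    intro I hI
    have hI' : IsCoatom I := Ideal.isMaximal_def.1 hI
    have h1 := h I (isSimpleModule_iff_isCoatom.2 hI') (Submodule.Quotient.mk 1)
    rw [← Submodule.Quotient.mk_smul, smul_eq_mul, mul_one, Submodule.Quotient.mk_eq_zero] at h1
    exact h1
  rwa [IsSemisimpleRing.jacobson_eq_bot] at hx

/-- Frobenius's theorem in abstract form: under the hypotheses of
`Representation.sum_char_eq_zero_or_eq_card_mul_finrank`, the set `K` is closed under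
multiplication. -/
theorem mul_mem_of_sum_class_function {G : Type*} [Group G] [Fintype G]
    (H : Subgroup G) [Fintype H] (K : Finset G) (one_mem : 1 ∈ K)
    (hconj : ∀ g, ∀ k ∈ K, g * k * g⁻¹ ∈ K)
    (hsum : ∀ F : G → ℂ, (∀ g x, F (g * x * g⁻¹) = F x) →
      ∑ g, F g = ∑ k ∈ K, F k + K.card * (∑ h : H, F h - F 1))
    {a b : G} (ha : a ∈ K) (hb : b ∈ K) : a * b ∈ K := by
  classical
  set σ : MonoidAlgebra ℂ G := ∑ k ∈ K, MonoidAlgebra.of ℂ G k with hσ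
  have hidem : σ * σ - (K.card : ℂ) • σ = 0 := by
    refine IsSemisimpleRing.eq_zero_of_forall_isSimpleModule fun I hI m => ?_
    let ρ := Representation.ofScalarTower (k := ℂ) (G := G) (M := MonoidAlgebra ℂ G ⧸ I)
    have hirr : ρ.IsIrreducible := Representation.isIrreducible_ofScalarTower
    have hact : ρ.asAlgebraHom σ = ∑ k ∈ K, ρ k := by
      rw [hσ, map_sum]
      exact Finset.sum_congr rfl fun k _ => Representation.asAlgebraHom_of ρ k
    have h0 : ρ.asAlgebraHom (σ * σ - (K.card : ℂ) • σ) = 0 := by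
      rw [map_sub, map_mul, map_smul, hact]
      rcases Representation.sum_apply_eq_zero_or_eq_card_smul ρ H K one_mem hconj hsum with h | h
      · rw [h]; simp
      · rw [h]; simp
    have h1 : (σ * σ - (K.card : ℂ) • σ) • m = 0 := by
      rw [← Representation.asAlgebraHom_ofScalarTower_apply, h0, LinearMap.zero_apply]
    exact h1
  by_contra hab
  have hσc : ∀ g, σ.coeff g = if g ∈ K then 1 else 0 := fun g => by
    rw [hσ, MonoidAlgebra.coeff_sum, Finsupp.finsetSum_apply]
    simp [Finsupp.single_apply]
  have hσσ : (σ * σ).coeff (a * b) = (∑ k ∈ K, ∑ l ∈ K, if k * l = a * b then 1 else 0 : ℕ) := by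
    rw [hσ, Finset.sum_mul_sum, MonoidAlgebra.coeff_sum, Finsupp.finsetSum_apply]
    simp_rw [MonoidAlgebra.coeff_sum, Finsupp.finsetSum_apply, ← map_mul]
    push_cast
    simp [Finsupp.single_apply]
  -- The coefficient of `σ * σ` at `a * b` counts factorizations within `K`, so it is positive; that
  -- of `|K|σ` is zero if `a * b ∉ K`.
  have hcoef := congrArg (fun x : MonoidAlgebra ℂ G => x.coeff (a * b)) (sub_eq_zero.1 hidem)
  simp only [MonoidAlgebra.coeff_smul_apply, hσc, if_neg hab, hσσ, smul_zero] at hcoef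
  rw [Nat.cast_eq_zero, Finset.sum_eq_zero_iff] at hcoef
  have h1 := Finset.sum_eq_zero_iff.1 (hcoef a ha) b hb
  simp at h1

/-! ### Frobenius groups and Frobenius's theorem -/

namespace IsFrobeniusGroup

variable {G Ω : Type*} [Group G] [MulAction G Ω]

/-- By transitivity the conjugates of `H` are exactly the point stabilizers. -/
theorem mem_frobeniusKernel_iff (hG : IsFrobeniusGroup G Ω) (ω : Ω) {g : G} :
    g ∈ frobeniusKernel G ω ↔ g = 1 ∨ ∀ a : Ω, g • a ≠ a := by
  have := hG.transitive
  simp only [frobeniusKernel, Set.mem_union, Set.mem_compl_iff, Set.mem_iUnion, Set.mem_image,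
    SetLike.mem_coe, MulAction.mem_stabilizer_iff, Set.mem_singleton_iff, not_exists, not_and]
  rw [or_comm]
  refine or_congr_right ⟨fun h a ha => ?_, ?_⟩
  · obtain ⟨t, rfl⟩ := MulAction.exists_smul_eq G ω a
    refine h t (t⁻¹ * g * t) ?_ (by group)
    rw [mul_smul, mul_smul, ha, inv_smul_smul]
  · rintro h t x hx rfl
    exact h (t • ω) (by rw [mul_smul, mul_smul, inv_smul_smul, hx])

theorem one_mem_frobeniusKernel (hG : IsFrobeniusGroup G Ω) (ω : Ω) :
    (1 : G) ∈ frobeniusKernel G ω :=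
  (hG.mem_frobeniusKernel_iff ω).2 (Or.inl rfl)

theorem conj_mem_frobeniusKernel (hG : IsFrobeniusGroup G Ω) {ω : Ω} (g : G) {k : G}
    (hk : k ∈ frobeniusKernel G ω) : g * k * g⁻¹ ∈ frobeniusKernel G ω := by
  rw [hG.mem_frobeniusKernel_iff] at hk ⊢
  refine hk.imp (fun h => by simp [h]) fun h a ha => h (g⁻¹ • a) ?_
  rw [eq_inv_smul_iff, ← mul_smul, ← mul_smul]
  exact ha

theorem inv_mem_frobeniusKernel (hG : IsFrobeniusGroup G Ω) {ω : Ω} {k : G}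
    (hk : k ∈ frobeniusKernel G ω) : k⁻¹ ∈ frobeniusKernel G ω := by
  rw [hG.mem_frobeniusKernel_iff] at hk ⊢
  exact hk.imp (fun h => by simp [h]) fun h a ha => h a (inv_smul_eq_iff.1 ha).symm

theorem eq_one_of_mem_frobeniusKernel (hG : IsFrobeniusGroup G Ω) {ω : Ω} {k : G}
    (hk : k ∈ frobeniusKernel G ω) {a : Ω} (ha : k • a = a) : k = 1 :=
  ((hG.mem_frobeniusKernel_iff ω).1 hk).resolve_right fun h => h a ha

theorem finite_space (hG : IsFrobeniusGroup G Ω) (ω : Ω) : Finite Ω := by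
  have := hG.transitive
  have := hG.finite
  exact Finite.of_surjective (fun g : G => g • ω) (MulAction.surjective_smul G ω)

open Classical in
/-- The number of fixed points of an element of a Frobenius group. -/
theorem sum_fixed (hG : IsFrobeniusGroup G Ω) [Fintype Ω] (ω : Ω) (g : G) :
    (∑ a : Ω, if g • a = a then 1 else 0 : ℂ) =
      (if g ∈ frobeniusKernel G ω then 0 else 1) + if g = 1 then (Fintype.card Ω : ℂ) else 0 := by
  by_cases h1 : g = 1
  · subst h1
    simp [hG.one_mem_frobeniusKernel ω]
  by_cases hg : g ∈ frobeniusKernel G ω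
  · have h := ((hG.mem_frobeniusKernel_iff ω).1 hg).resolve_left h1
    simp [h, hg, h1]
  · have h := hg
    rw [hG.mem_frobeniusKernel_iff, not_or] at h
    push Not at h
    obtain ⟨-, a, ha⟩ := h
    have hiff : ∀ b, g • b = b ↔ b = a :=
      fun b => ⟨fun hb => hG.eq_of_fixed g h1 b a hb ha, fun hb => by rw [hb, ha]⟩
    simp [hiff, hg, h1]

open Classical in
/-- The sum of a class function over a Frobenius group, in terms of the kernel and the
complement. -/
theorem sum_class_function (hG : IsFrobeniusGroup G Ω) [Fintype G] [Fintype Ω] (ω : Ω)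
    (F : G → ℂ) (hF : ∀ g x, F (g * x * g⁻¹) = F x) :
    ∑ g, F g = ∑ k ∈ (frobeniusKernel G ω).toFinset, F k +
      Fintype.card Ω * (∑ h : frobeniusComplement G ω, F h - F 1) := by
  have := hG.transitive
  have hstab : ∀ a : Ω, ∑ g, (if g • a = a then F g else 0) =
      ∑ h : frobeniusComplement G ω, F h := by
    intro a
    obtain ⟨t, rfl⟩ := MulAction.exists_smul_eq G ω a
    have h1 : ∑ h : frobeniusComplement G ω, F h = ∑ g, if g • ω = ω then F g else 0 := by
      rw [← Finset.sum_filter]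
      exact (Finset.sum_subtype _ (fun x => by simp) F).symm
    rw [h1]
    refine (Fintype.sum_equiv (MulAut.conj t).toEquiv _ _ fun g => ?_).symm
    have h2 : (MulAut.conj t).toEquiv g = t * g * t⁻¹ := rfl
    rw [h2, hF]
    have h3 : (t * g * t⁻¹) • t • ω = t • ω ↔ g • ω = ω := by
      rw [mul_smul, mul_smul, inv_smul_smul, smul_left_cancel_iff]
    simp only [h3]
  -- Double count, weighted by `F`, of the pairs `(g, a)` with `g • a = a`.
  have hcount : Fintype.card Ω * ∑ h : frobeniusComplement G ω, F h =
      ∑ g, F g * ∑ a : Ω, (if g • a = a then 1 else 0 : ℂ) := by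
    have h1 : ∑ g, F g * ∑ a : Ω, (if g • a = a then 1 else 0 : ℂ) =
        ∑ a : Ω, ∑ g, if g • a = a then F g else 0 := by
      simp_rw [Finset.mul_sum, mul_ite, mul_one, mul_zero]
      exact Finset.sum_comm
    rw [h1]
    simp_rw [hstab]
    rw [Finset.sum_const, nsmul_eq_mul, Finset.card_univ]
  have hcompl : ∑ g, F g = ∑ k ∈ (frobeniusKernel G ω).toFinset, F k +
      ∑ g, F g * (if g ∈ frobeniusKernel G ω then 0 else 1) := by
    have h1 : ∑ k ∈ (frobeniusKernel G ω).toFinset, F k =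
        ∑ g, if g ∈ frobeniusKernel G ω then F g else 0 := by
      rw [← Finset.sum_filter]
      congr 1
      ext; simp
    rw [h1, ← Finset.sum_add_distrib]
    refine Finset.sum_congr rfl fun g _ => ?_
    split_ifs <;> simp
  simp_rw [hG.sum_fixed ω, mul_add, Finset.sum_add_distrib] at hcount
  have h1 : ∑ g, F g * (if g = 1 then (Fintype.card Ω : ℂ) else 0) = F 1 * Fintype.card Ω := by
    simp
  rw [h1] at hcount
  rw [hcompl]
  linear_combination -hcount

open Classical in
theorem card_frobeniusKernel (hG : IsFrobeniusGroup G Ω) [Fintype G] [Fintype Ω] (ω : Ω) :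
    (frobeniusKernel G ω).toFinset.card = Fintype.card Ω := by
  have := hG.transitive
  have h := hG.sum_class_function ω (fun _ => 1) fun _ _ => rfl
  have h1 : Fintype.card Ω * Fintype.card (frobeniusComplement G ω) = Fintype.card G := by
    have h2 := MulAction.card_orbit_mul_card_stabilizer_eq_card_group G ω
    have h3 : Fintype.card (MulAction.orbit G ω) = Fintype.card Ω := by
      rw [← Nat.card_eq_fintype_card, ← Nat.card_eq_fintype_card, MulAction.orbit_eq_univ,
        Nat.card_univ]
    rw [← h3]
    exact h2
  have h2 : (Fintype.card Ω : ℂ) * Fintype.card (frobeniusComplement G ω) = Fintype.card G := by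
    exact_mod_cast h1
  simp only [Finset.sum_const, nsmul_eq_mul, mul_one, Finset.card_univ] at h
  have h3 : ((frobeniusKernel G ω).toFinset.card : ℂ) = Fintype.card Ω := by
    linear_combination -h - h2
  exact_mod_cast h3

/-- **Frobenius's theorem**: the Frobenius kernel is closed under multiplication. -/
theorem mul_mem_frobeniusKernel (hG : IsFrobeniusGroup G Ω) {ω : Ω} {k l : G}
    (hk : k ∈ frobeniusKernel G ω) (hl : l ∈ frobeniusKernel G ω) :
    k * l ∈ frobeniusKernel G ω := by
  classical
  have := hG.finite
  have := hG.finite_space ω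
  have := Fintype.ofFinite G
  have := Fintype.ofFinite Ω
  have h := mul_mem_of_sum_class_function (frobeniusComplement G ω)
    (frobeniusKernel G ω).toFinset (by simpa using hG.one_mem_frobeniusKernel ω)
    (fun g k hk => by
      rw [Set.mem_toFinset] at hk ⊢
      exact hG.conj_mem_frobeniusKernel g hk)
    (fun F hF => by rw [hG.card_frobeniusKernel]; exact hG.sum_class_function ω F hF)
    (Set.mem_toFinset.2 hk) (Set.mem_toFinset.2 hl)
  exact Set.mem_toFinset.1 h

/-- The Frobenius kernel acts regularly. -/
theorem bijective_frobeniusKernel_smul (hG : IsFrobeniusGroup G Ω) (ω a : Ω) :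
    Function.Bijective fun k : frobeniusKernel G ω => (k : G) • a := by
  classical
  have := hG.finite
  have := hG.finite_space ω
  have := Fintype.ofFinite G
  have := Fintype.ofFinite Ω
  rw [Fintype.bijective_iff_injective_and_card]
  refine ⟨fun k l hkl => ?_, ?_⟩
  · have h1 : ((l : G)⁻¹ * k) = 1 := by
      refine hG.eq_one_of_mem_frobeniusKernel (a := a)
        (hG.mul_mem_frobeniusKernel (hG.inv_mem_frobeniusKernel l.2) k.2) ?_
      rw [mul_smul, inv_smul_eq_iff]
      exact hkl
    exact Subtype.ext (inv_mul_eq_one.1 h1).symm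
  · rw [← hG.card_frobeniusKernel ω, Set.toFinset_card]

/-- Every element factors as a kernel element times a complement element. -/
theorem exists_eq_mul (hG : IsFrobeniusGroup G Ω) (ω : Ω) (g : G) :
    ∃ (k : frobeniusKernel G ω) (h : frobeniusComplement G ω), g = k * h := by
  obtain ⟨k, hk⟩ := (hG.bijective_frobeniusKernel_smul ω ω).2 (g • ω)
  refine ⟨k, ⟨(k : G)⁻¹ * g, ?_⟩, by simp⟩
  rw [MulAction.mem_stabilizer_iff, mul_smul, inv_smul_eq_iff]
  exact hk.symm

theorem mul_injective (hG : IsFrobeniusGroup G Ω) {ω : Ω} {k k' : frobeniusKernel G ω}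
    {h h' : frobeniusComplement G ω} (heq : (k : G) * h = k' * h') : k = k' ∧ h = h' := by
  have hk : k = k' := by
    refine (hG.bijective_frobeniusKernel_smul ω ω).1 ?_
    have h1 := congrArg (· • ω) heq
    simpa only [mul_smul, MulAction.mem_stabilizer_iff.1 h.2,
      MulAction.mem_stabilizer_iff.1 h'.2] using h1
  subst hk
  exact ⟨rfl, Subtype.ext (mul_left_cancel heq)⟩

end IsFrobeniusGroup

/-! ### The span of the stars -/

open Classical in
theorem charVec_apply {G : Type*} (S : Set G) (g : G) :
    charVec S g = if g ∈ S then 1 else 0 := by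
  simp [charVec, Set.indicator_apply]

section CLSpan

variable (G Ω : Type*) [Group G] [MulAction G Ω]

/-- The space spanned by the characteristic vectors of the stars. -/
def clSpan : Submodule ℂ (G → ℂ) :=
  Submodule.span ℂ {v : G → ℂ | ∃ a b : Ω, v = charVec (clStar G a b)}

variable {G Ω}

theorem charVec_clStar_mem_clSpan (a b : Ω) : charVec (clStar G a b) ∈ clSpan G Ω :=
  Submodule.subset_span ⟨a, b, rfl⟩

theorem comp_mul_right_mem_clSpan {v : G → ℂ} (hv : v ∈ clSpan G Ω) (t : G) :
    (fun x => v (x * t)) ∈ clSpan G Ω := by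
  induction hv using Submodule.span_induction with
  | mem v hv =>
    obtain ⟨a, b, rfl⟩ := hv
    have h : (fun x => charVec (clStar G a b) (x * t)) = charVec (clStar G (t • a) b) := by
      classical
      funext x
      simp [charVec_apply, clStar, mul_smul]
    rw [h]
    exact charVec_clStar_mem_clSpan _ _
  | zero => exact Submodule.zero_mem _
  | add v w _ _ hv hw => exact Submodule.add_mem _ hv hw
  | smul c v _ hv => exact Submodule.smul_mem _ c hv

theorem IsCLSet.biUnion {ι : Type*} (F : Finset ι) (S : ι → Set G)
    (hS : ∀ i ∈ F, IsCLSet Ω (S i)) (hF : (F : Set ι).PairwiseDisjoint S) :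
    IsCLSet Ω (⋃ i ∈ F, S i) := by
  have h : charVec (⋃ i ∈ F, S i) = ∑ i ∈ F, charVec (S i) := by
    funext x
    rw [Finset.sum_apply]
    exact Finset.indicator_biUnion_apply F S hF x
  unfold IsCLSet
  rw [h]
  exact Submodule.sum_mem _ hS

end CLSpan

/-! ### Cameron-Liebler sets of a Frobenius group -/

namespace IsFrobeniusGroup

variable {G Ω : Type*} [Group G] [MulAction G Ω]

/-- The stars at `ω` add up to the all-ones vector, and the stars from `a` to `a` to the fixed-point
count; the vector is their difference. -/
theorem charVec_frobeniusKernel_sub_mem_clSpan (hG : IsFrobeniusGroup G Ω) [Fintype Ω] (ω : Ω) :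
    charVec (frobeniusKernel G ω) - (Fintype.card Ω : ℂ) • charVec {(1 : G)} ∈ clSpan G Ω := by
  classical
  have h : charVec (frobeniusKernel G ω) - (Fintype.card Ω : ℂ) • charVec {(1 : G)} =
      ∑ b : Ω, charVec (clStar G ω b) - ∑ a : Ω, charVec (clStar G a a) := by
    funext g
    have h1 := hG.sum_fixed ω g
    simp only [Pi.sub_apply, Pi.smul_apply, Finset.sum_apply, charVec_apply, clStar,
      Set.mem_ofPred_eq, Set.mem_singleton_iff, smul_eq_mul, mul_ite, mul_one, mul_zero]
    rw [h1]
    simp only [Finset.sum_ite_eq, Finset.mem_univ, if_true]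
    split_ifs <;> ring
  rw [h]
  exact Submodule.sub_mem _ (Submodule.sum_mem _ fun b _ => charVec_clStar_mem_clSpan _ _)
    (Submodule.sum_mem _ fun a _ => charVec_clStar_mem_clSpan _ _)

/-- Moving a point inside a coset of the kernel changes its characteristic vector by an element of
the span of the stars. -/
theorem charVec_singleton_sub_mem_clSpan (hG : IsFrobeniusGroup G Ω) {ω : Ω} {k : G}
    (hk : k ∈ frobeniusKernel G ω) (h : G) :
    charVec {k * h} - charVec {h} ∈ clSpan G Ω := by
  classical
  have := hG.finite_space ω
  have := Fintype.ofFinite Ω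
  have hcard : (Fintype.card Ω : ℂ) ≠ 0 := by
    have : Nonempty Ω := ⟨ω⟩
    exact_mod_cast Fintype.card_ne_zero
  have hmem := hG.charVec_frobeniusKernel_sub_mem_clSpan ω
  have h1 := comp_mul_right_mem_clSpan hmem (k * h)⁻¹
  have h2 := comp_mul_right_mem_clSpan hmem h⁻¹
  have h3 := Submodule.smul_mem _ (Fintype.card Ω : ℂ)⁻¹ (Submodule.sub_mem _ h2 h1)
  convert h3 using 1
  funext x
  -- Both translates involve the same coset `Kkh = Kh`, so their coset terms cancel and only the two
  -- points remain. This needs `K` closed under products.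
  have hK : x * (k * h)⁻¹ ∈ frobeniusKernel G ω ↔ x * h⁻¹ ∈ frobeniusKernel G ω := by
    rw [mul_inv_rev, ← mul_assoc]
    refine ⟨fun hx => ?_, fun hx => hG.mul_mem_frobeniusKernel hx (hG.inv_mem_frobeniusKernel hk)⟩
    simpa using hG.mul_mem_frobeniusKernel hx hk
  have e1 : x * (k * h)⁻¹ = 1 ↔ x = k * h := mul_inv_eq_one
  have e2 : x * h⁻¹ = 1 ↔ x = h := mul_inv_eq_one
  simp only [Pi.sub_apply, Pi.smul_apply, charVec_apply, Set.mem_singleton_iff, smul_eq_mul, hK,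
    e1, e2]
  field_simp
  ring

/-- `S_f` arises from the star `H` by moving each `h` to `f(h)h` within its coset `Kh`. -/
theorem isCLSet_transversalSet (hG : IsFrobeniusGroup G Ω) {ω : Ω}
    (f : frobeniusComplement G ω → frobeniusKernel G ω) : IsCLSet Ω (transversalSet f) := by
  classical
  have := hG.finite
  have := Fintype.ofFinite G
  have h1 : charVec (transversalSet f) =
      ∑ h : frobeniusComplement G ω, charVec {(f h : G) * h} := by
    funext x
    simp only [Finset.sum_apply, charVec_apply, Set.mem_singleton_iff]
    by_cases hx : x ∈ transversalSet f
    · obtain ⟨h, rfl⟩ := hx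
      have h2 : ∀ h', (f h : G) * h = f h' * h' ↔ h = h' :=
        fun h' => ⟨fun e => (hG.mul_injective e).2, fun e => by rw [e]⟩
      rw [if_pos ⟨h, rfl⟩]
      simp [h2]
    · rw [if_neg hx, Finset.sum_eq_zero]
      exact fun h _ => if_neg fun e => hx ⟨h, e⟩
  have h2 : charVec (clStar G ω ω) = ∑ h : frobeniusComplement G ω, charVec {(h : G)} := by
    funext x
    simp only [Finset.sum_apply, charVec_apply, Set.mem_singleton_iff]
    by_cases hx : x ∈ clStar G ω ω
    · have h3 : ∀ h' : frobeniusComplement G ω, x = h' ↔ ⟨x, hx⟩ = h' :=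
        fun h' => by rw [Subtype.ext_iff]
      simp [h3, hx]
    · rw [if_neg hx, Finset.sum_eq_zero]
      exact fun h _ => if_neg fun e => hx (by rw [e]; exact h.2)
  have h3 : charVec (transversalSet f) = charVec (clStar G ω ω) +
      ∑ h : frobeniusComplement G ω, (charVec {(f h : G) * h} - charVec {(h : G)}) := by
    rw [h1, h2, Finset.sum_sub_distrib]; abel
  unfold IsCLSet
  rw [h3]
  exact Submodule.add_mem _ (charVec_clStar_mem_clSpan _ _)
    (Submodule.sum_mem _ fun h _ => hG.charVec_singleton_sub_mem_clSpan (f h).2 h)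

open Classical in
/-- Vectors in the span of the stars have the same sum over all cosets of the kernel. -/
theorem sum_coset_eq (hG : IsFrobeniusGroup G Ω) {ω : Ω} [Fintype (frobeniusKernel G ω)]
    {v : G → ℂ} (hv : v ∈ clSpan G Ω) (g : G) :
    ∑ k : frobeniusKernel G ω, v (k * g) = ∑ k : frobeniusKernel G ω, v k := by
  induction hv using Submodule.span_induction with
  | mem v hv =>
    obtain ⟨a, b, rfl⟩ := hv
    have h : ∀ g : G, ∑ k : frobeniusKernel G ω, charVec (clStar G a b) (k * g) = 1 := by
      intro g
      obtain ⟨k, hk⟩ := (hG.bijective_frobeniusKernel_smul ω (g • a)).2 b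
      have h1 : ∀ l : frobeniusKernel G ω, ((l : G) * g) • a = b ↔ l = k := fun l =>
        ⟨fun e => (hG.bijective_frobeniusKernel_smul ω (g • a)).1 (by
          rw [mul_smul] at e; exact e.trans hk.symm), fun e => by rw [e, mul_smul]; exact hk⟩
      simp [charVec_apply, clStar, h1]
    have h1 := h 1
    simp only [mul_one] at h1
    rw [h, h1]
  | zero => simp
  | add v w _ _ hv hw => simp [Finset.sum_add_distrib, hv, hw]
  | smul c v _ hv => simp [← Finset.mul_sum, hv]

/-- A Cameron-Liebler set meets all cosets of the kernel in equally many points. -/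
theorem exists_card_coset_eq (hG : IsFrobeniusGroup G Ω) (ω : Ω) {L : Set G} (hL : IsCLSet Ω L) :
    ∃ m : ℕ, ∀ g : G, Nat.card {k : frobeniusKernel G ω // (k : G) * g ∈ L} = m := by
  classical
  have := hG.finite
  have := Fintype.ofFinite G
  have h : ∀ g : G, (Nat.card {k : frobeniusKernel G ω // (k : G) * g ∈ L} : ℂ) =
      ∑ k : frobeniusKernel G ω, charVec L (k * g) := by
    intro g
    simp [charVec_apply, Fintype.card_subtype]
  refine ⟨Nat.card {k : frobeniusKernel G ω // (k : G) * 1 ∈ L}, fun g => ?_⟩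
  have h1 : (Nat.card {k : frobeniusKernel G ω // (k : G) * g ∈ L} : ℂ) =
      Nat.card {k : frobeniusKernel G ω // (k : G) * 1 ∈ L} := by
    rw [h, h, hG.sum_coset_eq hL, hG.sum_coset_eq hL]
  exact_mod_cast h1

theorem isCLSet_iff (hG : IsFrobeniusGroup G Ω) (ω : Ω) (L : Set G) :
    IsCLSet Ω L ↔ ∃ F : Set (frobeniusComplement G ω → frobeniusKernel G ω),
      F.PairwiseDisjoint transversalSet ∧ L = ⋃ f ∈ F, transversalSet f := by
  have := hG.finite
  constructor
  · intro hL
    obtain ⟨m, hm⟩ := hG.exists_card_coset_eq ω hL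
    -- An arbitrary numbering of `L ∩ Kh` for each `h`; the points numbered `i` form the `i`-th
    -- transversal.
    let e : ∀ h : frobeniusComplement G ω,
        {k : frobeniusKernel G ω // (k : G) * h ∈ L} ≃ Fin m :=
      fun h => Finite.equivFinOfCardEq (hm h)
    let f : Fin m → frobeniusComplement G ω → frobeniusKernel G ω :=
      fun i h => ((e h).symm i : frobeniusKernel G ω)
    refine ⟨Set.range f, ?_, ?_⟩
    · rintro _ ⟨i, rfl⟩ _ ⟨j, rfl⟩ hij
      refine Set.disjoint_left.2 ?_
      rintro x ⟨h, rfl⟩ ⟨h', hx⟩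
      obtain ⟨h1, rfl⟩ := hG.mul_injective hx
      have h2 : i = j := (e h).symm.injective (Subtype.ext h1)
      exact hij (by rw [h2])
    · ext x
      simp only [Set.mem_iUnion, Set.mem_range, exists_prop, exists_exists_eq_and]
      constructor
      · intro hx
        obtain ⟨k, h, rfl⟩ := hG.exists_eq_mul ω x
        refine ⟨e h ⟨k, hx⟩, h, ?_⟩
        simp [f]
      · rintro ⟨i, h, rfl⟩
        exact ((e h).symm i).2
  · rintro ⟨F, hF, rfl⟩
    have hfin := Set.toFinite F
    have h := IsCLSet.biUnion hfin.toFinset transversalSet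
      (fun f _ => hG.isCLSet_transversalSet f) (by simpa using hF)
    simpa using h

theorem eq_of_transversalSet_subset (hG : IsFrobeniusGroup G Ω) {ω : Ω}
    {f f' : frobeniusComplement G ω → frobeniusKernel G ω}
    (h : transversalSet f ⊆ transversalSet f') : f = f' := by
  funext x
  obtain ⟨y, hy⟩ := h ⟨x, rfl⟩
  obtain ⟨h1, rfl⟩ := hG.mul_injective hy
  exact h1

theorem exists_transversalSet_subset (hG : IsFrobeniusGroup G Ω) (ω : Ω) {L : Set G}
    (hL : IsCLSet Ω L) (hne : L.Nonempty) :
    ∃ f : frobeniusComplement G ω → frobeniusKernel G ω, transversalSet f ⊆ L := by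
  obtain ⟨F, -, rfl⟩ := (hG.isCLSet_iff ω L).1 hL
  obtain ⟨x, hx⟩ := hne
  obtain ⟨f, hf, -⟩ := Set.mem_iUnion₂.1 hx
  exact ⟨f, Set.subset_biUnion_of_mem hf⟩

/-- Every non-empty CL set contains some `S_f`, and the sets `S_f` form an antichain. -/
theorem isMinimalCLSet_iff (hG : IsFrobeniusGroup G Ω) (ω : Ω) (L : Set G) :
    IsMinimalCLSet Ω L ↔
      ∃ f : frobeniusComplement G ω → frobeniusKernel G ω, L = transversalSet f := by
  have hne : ∀ f : frobeniusComplement G ω → frobeniusKernel G ω, (transversalSet f).Nonempty :=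
    fun f => ⟨_, 1, rfl⟩
  constructor
  · rintro ⟨hL, hL0, hmin⟩
    obtain ⟨f, hf⟩ := hG.exists_transversalSet_subset ω hL hL0
    by_contra hcon
    exact hmin _ (hG.isCLSet_transversalSet f) (hne f)
      (hf.ssubset_of_ne fun h => hcon ⟨f, h.symm⟩)
  · rintro ⟨f, rfl⟩
    refine ⟨hG.isCLSet_transversalSet f, hne f, fun M hM hM0 hlt => ?_⟩
    obtain ⟨f', hf'⟩ := hG.exists_transversalSet_subset ω hM hM0
    obtain rfl := hG.eq_of_transversalSet_subset (hf'.trans hlt.subset)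
    exact hlt.not_subset hf'

end IsFrobeniusGroup

theorem mainTheorem1 {G Ω : Type*} [Group G] [MulAction G Ω] (hG : IsFrobeniusGroup G Ω) (ω : Ω) :
    (∀ f : frobeniusComplement G ω → frobeniusKernel G ω, IsCLSet Ω (transversalSet f)) ∧
    (∀ L : Set G, IsMinimalCLSet Ω L ↔
      ∃ f : frobeniusComplement G ω → frobeniusKernel G ω, L = transversalSet f) ∧
    (∀ L : Set G, IsCLSet Ω L ↔
      ∃ F : Set (frobeniusComplement G ω → frobeniusKernel G ω),
        F.PairwiseDisjoint transversalSet ∧ L = ⋃ f ∈ F, transversalSet f) :=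
  ⟨hG.isCLSet_transversalSet, hG.isMinimalCLSet_iff ω, hG.isCLSet_iff ω⟩
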